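/- For $n\ge 0$, a generalized Dyck path of length $n$ with set of steps $\{[1,2],[1,1],[1,0],[1,-1],[1,-2]\}$ is a lattice walk from $(0,0)$ to $(n,0)$ in which every step is of the form $(x,y)\to(x+1,y+s)$ with $s\in\{2,1,0,-1,-2\}$ and which always stays in the region $y\ge 0$. The area under such a path is the sum of the $y$-coordinates of its intermediate points (equivalently, the area between the path and the $x$-axis). Let $A(n)$ be the sum of the areas under all generalized Dyck paths of length $n$ with this set of steps, and let $X=X(t)=\sum_{n\ge 0}A(n)t^n\in\mathbb{Z}[[t]]$. Then $$ \begin{aligned} &t^{2}\left(775t^{4}-1460t^{3}+1006t^{2}-264t+24\right)\\ &+(t-1)(5t-1)\left(425t^{6}-1520t^{5}+1527t^{4}-68t^{3}-282t^{2}+88t-8\right)X\\ &-t\left(150t^{5}+540t^{4}-889t^{3}-240t^{2}+228t-32\right)(t-1)^{2}(5t-1)^{2}X^{2}\\ &-2t^{2}(5t+4)\left(5t^{3}-t^{2}-17t+4\right)(t-1)^{3}(5t-1)^{3}X^{3}\\ &+t^{4}(5t+4)^{2}(t-1)^{4}(5t-1)^{4}X^{4}=0 . \end{aligned} $$ Moreover,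 the first $30$ coefficients $A(0),A(1),\dots,A(29)$ are $0$, $0$, $3$, $18$, $113$, $636$, $3487$, $18656$, $98429$, $514012$, $2664690$, $13737758$, $70522801$, $360806214$, $1840913908$, $9371761174$, $47621259557$, $241601881822$, $1224111502194$, $6195045902854$, $31321134873744$, $158217553824544$, $798622703316154$, $4028438371631942$, $20308239308212037$, $102323623873153810$, $515313296262175206$, $2594054240062008690$, $13053194513626873348$, $65659889953142043376$. -/

import Mathlib

namespace GenDyck

/-- The height (the `y`-coordinate) reached after the first `k` steps of the walk that starts at
`(0, 0)` and whose `i`-th step is `(x, y) ↦ (x + 1, y + w i)`. -/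
def height {n : ℕ} (w : Fin n → ℤ) (k : ℕ) : ℤ :=
  ∑ i : Fin n with i.val < k, w i

/-- The generalized Dyck paths of length `n` with set of steps `{[1, s] : s ∈ S}`: the walks from
`(0, 0)` to `(n, 0)` with these steps that stay weakly above the `x`-axis. -/
def paths (S : Finset ℤ) (n : ℕ) : Finset (Fin n → ℤ) :=
  (Fintype.piFinset fun _ : Fin n => S).filter fun w : Fin n → ℤ =>
    (∀ k ≤ n, 0 ≤ height w k) ∧ height w n = 0

/-- The area under a path: the sum of the `y`-coordinates of its intermediate points. (As both
endpoints of a generalized Dyck path have height `0`, this is the area between the path and the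
`x`-axis.) -/
def area {n : ℕ} (w : Fin n → ℤ) : ℤ :=
  ∑ k ∈ Finset.Ioo 0 n, height w k

/-- The total area under all generalized Dyck paths of length `n` with set of steps `S`. -/
def totalArea (S : Finset ℤ) (n : ℕ) : ℤ :=
  ∑ w ∈ paths S n, area w

/-- The generating function `∑ₙ totalArea S n * tⁿ`. -/
noncomputable def areaGF (S : Finset ℤ) : PowerSeries ℤ :=
  PowerSeries.mk (totalArea S)

end GenDyck

/-! ### First-step recursions for counts and areas -/

namespace GenDyck

open Finset

/-! Kernel method. Letting the starting height `k` vary gives linear first-step equations for the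
series `C k` counting walks down to 0 and `D k` summing their heights; `D k` has source `k * C k`.
The small roots u, v of the kernel 1 - t(z^2 + z + 1 + 1/z + 1/z^2) are the roots of z^2 - a z - p,
with p = -uv = t r and a = u + v = p/(1 - p). Then t = p(1 - p)^2/N with N = 1 - p + p^2 - p^3 +
p^4, and `C k = r * h k` for `h = kernelSeq a p` (`countGF_eq`). The source `k * h k` is resonant,
so `D k` is `h k` and `h (k + 1)` with coefficients quadratic in `k` (`areaDenom_mul_heightGF`).
These formulas hold because the equations have unique power series solutions
(`eq_zero_of_transfer`). At `k = 0`, both t and Y = (t - 1)(5t - 1)X are rational in p, and the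
quartic is an identity in p. The coefficients come from running the recursions numerically. -/

/-- The walks of length `n` with steps in `S` that start at height `y`, end at height `0`
and stay weakly above the `x`-axis. -/
def pathsFrom (S : Finset ℤ) (n : ℕ) (y : ℤ) : Finset (Fin n → ℤ) :=
  (Fintype.piFinset fun _ : Fin n => S).filter fun w : Fin n → ℤ =>
    (∀ k ≤ n, 0 ≤ y + height w k) ∧ y + height w n = 0

/-- The number of walks in `pathsFrom S n y`. -/
def countFrom (S : Finset ℤ) (n : ℕ) (y : ℤ) : ℤ := ∑ _w ∈ pathsFrom S n y, 1

/-- The sum of all heights along all walks in `pathsFrom S n y`. -/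
def areaFrom (S : Finset ℤ) (n : ℕ) (y : ℤ) : ℤ :=
  ∑ w ∈ pathsFrom S n y, ∑ k ∈ range (n + 1), (y + height w k)

lemma height_zero {n : ℕ} (w : Fin n → ℤ) : height w 0 = 0 := by
  simp [height]

lemma height_cons_succ {n : ℕ} (s : ℤ) (w : Fin n → ℤ) (k : ℕ) :
    height (Fin.cons s w : Fin (n + 1) → ℤ) (k + 1) = s + height w k := by
  simp [height, Finset.sum_filter, Fin.sum_univ_succ]

lemma pathsFrom_of_neg (S : Finset ℤ) (n : ℕ) {y : ℤ} (hy : y < 0) : pathsFrom S n y = ∅ := by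
  refine Finset.filter_eq_empty_iff.2 fun w _ h => ?_
  have := h.1 0 n.zero_le
  rw [height_zero] at this
  omega

lemma cons_mem_pathsFrom {S : Finset ℤ} {n : ℕ} {y s : ℤ} {w : Fin n → ℤ} (hy : 0 ≤ y) :
    (Fin.cons s w : Fin (n + 1) → ℤ) ∈ pathsFrom S (n + 1) y ↔
      s ∈ S ∧ w ∈ pathsFrom S n (y + s) := by
  simp only [pathsFrom, mem_filter, Fintype.mem_piFinset, Fin.forall_fin_succ, Fin.cons_zero,
    Fin.cons_succ, height_cons_succ, ← add_assoc, and_assoc]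
  refine and_congr_right fun _ => and_congr_right fun _ => and_congr_left fun _ => ?_
  constructor
  · intro h k hk
    simpa [height_cons_succ, add_assoc] using h (k + 1) (by omega)
  · rintro h (_ | k) hk
    · simpa [height_zero] using hy
    · simpa [height_cons_succ, add_assoc] using h k (by omega)

/-- Splits a walk into its first step and the rest; arbitrary `f` covers both counts and areas. -/
lemma sum_pathsFrom_succ (S : Finset ℤ) (n : ℕ) {y : ℤ} (hy : 0 ≤ y)
    (f : (Fin (n + 1) → ℤ) → ℤ) :
    ∑ w ∈ pathsFrom S (n + 1) y, f w =
      ∑ s ∈ S, ∑ w ∈ pathsFrom S n (y + s), f (Fin.cons s w) := by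
  rw [Finset.sum_sigma']
  symm
  refine Finset.sum_bij' (fun x _ => (Fin.cons x.1 x.2 : Fin (n + 1) → ℤ))
    (fun w _ => ⟨w 0, Fin.tail w⟩) ?_ ?_ ?_ ?_ ?_
  · rintro ⟨s, w⟩ h
    exact (cons_mem_pathsFrom hy).2 (by simpa using h)
  · intro w h
    rw [← Fin.cons_self_tail w, cons_mem_pathsFrom hy] at h
    simpa using h
  · rintro ⟨s, w⟩ _
    simp
  · intro w _
    simp
  · rintro ⟨s, w⟩ _
    rfl

lemma countFrom_succ (S : Finset ℤ) (n : ℕ) {y : ℤ} (hy : 0 ≤ y) :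
    countFrom S (n + 1) y = ∑ s ∈ S, countFrom S n (y + s) :=
  sum_pathsFrom_succ S n hy _

lemma areaFrom_succ (S : Finset ℤ) (n : ℕ) {y : ℤ} (hy : 0 ≤ y) :
    areaFrom S (n + 1) y = y * countFrom S (n + 1) y + ∑ s ∈ S, areaFrom S n (y + s) := by
  rw [countFrom_succ S n hy, areaFrom, sum_pathsFrom_succ S n hy, mul_sum, ← sum_add_distrib]
  refine sum_congr rfl fun s _ => ?_
  rw [countFrom, areaFrom, mul_sum, ← sum_add_distrib]
  refine sum_congr rfl fun w _ => ?_
  rw [sum_range_succ' _ (n + 1), height_zero, add_comm]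
  simp [height_cons_succ, add_assoc]

lemma countFrom_of_neg (S : Finset ℤ) (n : ℕ) {y : ℤ} (hy : y < 0) : countFrom S n y = 0 := by
  simp [countFrom, pathsFrom_of_neg S n hy]

lemma areaFrom_of_neg (S : Finset ℤ) (n : ℕ) {y : ℤ} (hy : y < 0) : areaFrom S n y = 0 := by
  simp [areaFrom, pathsFrom_of_neg S n hy]

lemma countFrom_zero (S : Finset ℤ) (y : ℤ) : countFrom S 0 y = if y = 0 then 1 else 0 := by
  simp only [countFrom, pathsFrom, height, Finset.univ_eq_empty, filter_empty, sum_empty,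
    Finset.sum_filter]
  by_cases hy : y = 0 <;> simp [hy]

lemma areaFrom_zero (S : Finset ℤ) (y : ℤ) : areaFrom S 0 y = 0 := by
  simp only [areaFrom, pathsFrom, height, Finset.univ_eq_empty, filter_empty, sum_empty,
    Finset.sum_filter]
  by_cases hy : y = 0 <;> simp [hy]

/-- Only the endpoints are added to the sum, and they have height 0. -/
lemma totalArea_eq_areaFrom (S : Finset ℤ) (n : ℕ) : totalArea S n = areaFrom S n 0 := by
  simp only [totalArea, areaFrom, paths, pathsFrom, zero_add]
  refine sum_congr rfl fun w hw => ?_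
  rw [mem_filter] at hw
  rw [area]
  refine sum_subset (fun k hk => ?_) fun k hk hk' => ?_
  · simp only [mem_Ioo, mem_range] at *
    omega
  · simp only [mem_Ioo, mem_range] at *
    obtain rfl | rfl : k = 0 ∨ k = n := by omega
    · exact height_zero w
    · exact hw.2.2

end GenDyck

/-! ### Functional equations in power series -/

namespace GenDyck

open Finset PowerSeries

/-- A map of power series that increases the `X`-adic order of differences has a fixed point. -/
lemma exists_fixedPoint {R : Type*} [CommRing R] (Φ : PowerSeries R → PowerSeries R)
    (hΦ : ∀ f g, X * (f - g) ∣ Φ f - Φ g) : ∃ f, Φ f = f := by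
  let s : ℕ → PowerSeries R := fun n => Φ^[n] 0
  have hs (n : ℕ) : s (n + 1) = Φ (s n) := Function.iterate_succ_apply' Φ n 0
  have step (n : ℕ) : X ^ n ∣ s (n + 1) - s n := by
    induction n with
    | zero => simp
    | succ n ih =>
      have h := hΦ (s (n + 1)) (s n)
      rw [← hs, ← hs] at h
      rw [pow_succ']
      exact (mul_dvd_mul_left X ih).trans h
  have step' (n m : ℕ) (h : n ≤ m) : X ^ n ∣ s m - s n := by
    induction m, h using Nat.le_induction with
    | base => simp
    | succ m h ih =>
      have := dvd_add ((pow_dvd_pow X h).trans (step m)) ih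
      simpa using this
  let f : PowerSeries R := mk fun n => coeff n (s (n + 1))
  have hf (n : ℕ) : X ^ n ∣ f - s n := by
    rw [X_pow_dvd_iff]
    intro m hm
    have := X_pow_dvd_iff.1 (step' (m + 1) n hm) m (by omega)
    rw [map_sub, sub_eq_zero] at this
    simp [f, this]
  refine ⟨f, ?_⟩
  ext n
  have h1 : X ^ (n + 1) ∣ Φ f - s (n + 1) := by
    rw [hs, pow_succ']
    exact (mul_dvd_mul_left X (hf n)).trans (hΦ _ _)
  have h2 := X_pow_dvd_iff.1 (dvd_sub h1 (hf (n + 1))) n (by omega)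
  rw [sub_sub_sub_cancel_right, map_sub, sub_eq_zero] at h2
  exact h2

/-- A sequence of power series annihilated by the transfer operator of the walks with steps
`-2, …, 2` on the half line vanishes. -/
lemma eq_zero_of_transfer {R : Type*} [CommRing R] (E : ℕ → PowerSeries R)
    (h0 : E 0 = X * (E 0 + E 1 + E 2))
    (h1 : E 1 = X * (E 0 + E 1 + E 2 + E 3))
    (h2 : ∀ k, E (k + 2) = X * (E k + E (k + 1) + E (k + 2) + E (k + 3) + E (k + 4))) (k : ℕ) :
    E k = 0 := by
  have key (n : ℕ) : ∀ k, X ^ n ∣ E k := by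
    induction n with
    | zero => simp
    | succ n ih =>
      rintro (_ | _ | k)
      · rw [h0, pow_succ']
        exact mul_dvd_mul_left X (dvd_add (dvd_add (ih _) (ih _)) (ih _))
      · rw [h1, pow_succ']
        exact mul_dvd_mul_left X (dvd_add (dvd_add (dvd_add (ih _) (ih _)) (ih _)) (ih _))
      · rw [h2, pow_succ']
        exact mul_dvd_mul_left X
          (dvd_add (dvd_add (dvd_add (dvd_add (ih _) (ih _)) (ih _)) (ih _)) (ih _))
  ext n
  exact X_pow_dvd_iff.1 (key (n + 1) k) n (by omega)

/-- The set of steps `{-2, …, 2}`. -/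
abbrev steps : Finset ℤ := {2, 1, 0, -1, -2}

/-- The generating function of the walks from height `k` to height `0`. -/
noncomputable def countGF (k : ℕ) : PowerSeries ℤ := mk fun n => countFrom steps n k

/-- The generating function of the total heights of the walks from height `k` to height `0`. -/
noncomputable def heightGF (k : ℕ) : PowerSeries ℤ := mk fun n => areaFrom steps n k

lemma areaGF_steps : areaGF steps = heightGF 0 := by
  ext n
  simp [areaGF, heightGF, totalArea_eq_areaFrom]

lemma sum_steps (f : ℤ → ℤ) :
    ∑ s ∈ steps, f s = f 2 + f 1 + f 0 + f (-1) + f (-2) := by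
  simp [steps, add_assoc]

lemma countGF_zero : countGF 0 = 1 + X * (countGF 0 + countGF 1 + countGF 2) := by
  ext (_ | n)
  · simp [countGF, countFrom_zero]
  · simp only [countGF, map_add, coeff_mk, coeff_succ_X_mul, coeff_one]
    rw [countFrom_succ _ _ (by simp), sum_steps]
    simp [countFrom_of_neg]
    ring

lemma countGF_one :
    countGF 1 = X * (countGF 0 + countGF 1 + countGF 2 + countGF 3) := by
  ext (_ | n)
  · simp [countGF, countFrom_zero]
  · simp only [countGF, map_add, coeff_mk, coeff_succ_X_mul]
    rw [countFrom_succ _ _ (by simp), sum_steps]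
    norm_num [countFrom_of_neg]
    ring

lemma countGF_add_two (k : ℕ) :
    countGF (k + 2) = X * (countGF k + countGF (k + 1) + countGF (k + 2) + countGF (k + 3)
      + countGF (k + 4)) := by
  ext (_ | n)
  · simp [countGF, countFrom_zero]
    omega
  · simp only [countGF, map_add, coeff_mk, coeff_succ_X_mul]
    rw [countFrom_succ _ _ (by positivity), sum_steps]
    push_cast
    ring_nf

lemma heightGF_zero : heightGF 0 = X * (heightGF 0 + heightGF 1 + heightGF 2) := by
  ext (_ | n)
  · simp [heightGF, areaFrom_zero]
  · simp only [heightGF, map_add, coeff_mk, coeff_succ_X_mul]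
    rw [areaFrom_succ _ _ (by simp), sum_steps]
    simp [areaFrom_of_neg]
    ring

lemma heightGF_one :
    heightGF 1 = countGF 1 + X * (heightGF 0 + heightGF 1 + heightGF 2 + heightGF 3) := by
  ext (_ | n)
  · simp [heightGF, countGF, areaFrom_zero, countFrom_zero]
  · simp only [heightGF, countGF, map_add, coeff_mk, coeff_succ_X_mul]
    rw [areaFrom_succ _ _ (by simp), sum_steps]
    norm_num [areaFrom_of_neg]
    ring

lemma heightGF_add_two (k : ℕ) :
    heightGF (k + 2) = (k + 2 : PowerSeries ℤ) * countGF (k + 2) +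
      X * (heightGF k + heightGF (k + 1) + heightGF (k + 2) + heightGF (k + 3)
      + heightGF (k + 4)) := by
  obtain ⟨c, hc⟩ : ∃ c : ℤ, c = k + 2 := ⟨_, rfl⟩
  have hk : (k + 2 : PowerSeries ℤ) = C c := by simp [hc]
  rw [hk]
  ext (_ | n)
  · simp [heightGF, countGF, areaFrom_zero, countFrom_zero]
    omega
  · simp only [heightGF, countGF, map_add, coeff_mk, coeff_succ_X_mul, coeff_C_mul]
    rw [areaFrom_succ _ _ (by positivity), sum_steps, hc]
    push_cast
    ring_nf

/-- The series `r` with `t * r = p`, where `p` is the negative of the product of the small roots of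
the kernel of the walks with steps `-2, …, 2`. -/
lemma exists_kernel_series : ∃ r : PowerSeries ℤ,
    r * (1 - X * r) ^ 2 =
      1 - X * r + (X * r) ^ 2 - (X * r) ^ 3 + (X * r) ^ 4 := by
  -- The equation solved for its linear term `r`: every other occurrence of `r` carries a factor
  -- `X`, so the map is contracting. The witness is the divided difference.
  obtain ⟨r, hr⟩ := exists_fixedPoint (R := ℤ) (fun r => 1 - X * r + (X * r) ^ 2 - (X * r) ^ 3 +
    (X * r) ^ 4 + 2 * X * r ^ 2 - X ^ 2 * r ^ 3) (fun f g =>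
      ⟨-1 + X * (f + g) - X ^ 2 * (f ^ 2 + f * g + g ^ 2) +
        X ^ 3 * (f ^ 3 + f ^ 2 * g + f * g ^ 2 + g ^ 3) + 2 * (f + g) -
        X * (f ^ 2 + f * g + g ^ 2), by ring⟩)
  exact ⟨r, by linear_combination -hr⟩

end GenDyck

/-! ### Rational identities in the kernel parameter -/

namespace GenDyck

open PowerSeries

/-- The solution of `h (k + 2) = a * h (k + 1) + p * h k` with `h 0 = 1` and `h 1 = a`. -/
def kernelSeq {R : Type*} [CommRing R] (a p : R) : ℕ → R
  | 0 => 1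
  | 1 => a
  | k + 2 => a * kernelSeq a p (k + 1) + p * kernelSeq a p k

/-- A combination of `x = h k` and `z = h (k + 1)` for a solution `h` of
`h (k + 2) = a * h (k + 1) + p * h k`, quadratic in `y = k`, on which the transfer operator of the
walks acts as multiplication by a multiple of `y`. -/
def areaForm {R : Type*} [CommRing R] (p y x z : R) : R :=
  ((2 - 6 * p + 5 * p ^ 2 - 2 * p ^ 3) * (1 + p) * (1 - 3 * p + p ^ 2) * (1 - p + p ^ 2)
      * (y ^ 2 - 4)
    + (4 - 24 * p + 59 * p ^ 2 - 83 * p ^ 3 + 97 * p ^ 4 - 93 * p ^ 5 + 63 * p ^ 6 - 23 * p ^ 7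
      + 4 * p ^ 8) * (y + 2)) * x
  + ((1 - p) * (1 + p) ^ 2 * (1 - 3 * p + p ^ 2) * (1 - p + p ^ 2) * (y ^ 2 - 1)
    + (1 - p) ^ 2 * (1 + 4 * p - 9 * p ^ 2 + 4 * p ^ 3 + p ^ 4) * (1 + p) * (y + 1)) * z

/-- The eigenvalue factor attached to `areaForm`. -/
def areaDenom {R : Type*} [CommRing R] (p : R) : R :=
  2 * (1 + p) ^ 2 * (1 - 3 * p + p ^ 2) ^ 2 * (1 - p + p ^ 2) ^ 2 * (4 - 7 * p + 4 * p ^ 2)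

section Field

variable {K : Type*} [Field K] {p a : K}

/-- Holds because z^2 - a z - p divides N z^2 - p(1 - p)^2(1 + z + z^2 + z^3 + z^4). -/
lemma countGF_step_field (hp : 1 - p ≠ 0) (ha : a = p / (1 - p)) (h0 h1 h2 h3 h4 : K)
    (e2 : h2 = a * h1 + p * h0) (e3 : h3 = a * h2 + p * h1) (e4 : h4 = a * h3 + p * h2) :
    (1 - p + p ^ 2 - p ^ 3 + p ^ 4) * h2 = p * (1 - p) ^ 2 * (h0 + h1 + h2 + h3 + h4) := by
  subst e4 e3 e2 ha
  field_simp
  ring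

lemma areaForm_step_field (hp : 1 - p ≠ 0) (ha : a = p / (1 - p)) (y h0 h1 h2 h3 h4 h5 : K)
    (e2 : h2 = a * h1 + p * h0) (e3 : h3 = a * h2 + p * h1) (e4 : h4 = a * h3 + p * h2)
    (e5 : h5 = a * h4 + p * h3) :
    (1 - p + p ^ 2 - p ^ 3 + p ^ 4) * areaForm p (y + 2) h2 h3 =
      areaDenom p * (y + 2) * h2 + p * (1 - p) ^ 2 * (areaForm p y h0 h1 +
        areaForm p (y + 1) h1 h2 + areaForm p (y + 2) h2 h3 + areaForm p (y + 3) h3 h4 +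
        areaForm p (y + 4) h4 h5) := by
  subst e5 e4 e3 e2 ha
  simp only [areaForm, areaDenom]
  field_simp
  ring

/-- The general step, with the term at height -1 absent. Extend `h` by h(-1) = 0: the form vanishes
at y = -1, where the coefficient of `z` has the factor y + 1, and at y = -2, where that of `x` has
the factor y + 2. This is the boundary condition at the axis, used again at height 0. -/
lemma areaForm_step_one_field (hp : 1 - p ≠ 0) (ha : a = p / (1 - p)) (h2 h3 h4 : K)
    (e2 : h2 = a * a + p) (e3 : h3 = a * h2 + p * a) (e4 : h4 = a * h3 + p * h2) :
    (1 - p + p ^ 2 - p ^ 3 + p ^ 4) * areaForm p 1 a h2 =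
      areaDenom p * a + p * (1 - p) ^ 2 * (areaForm p 0 1 a + areaForm p 1 a h2 +
        areaForm p 2 h2 h3 + areaForm p 3 h3 h4) := by
  subst e4 e3 e2 ha
  simp only [areaForm, areaDenom]
  field_simp
  ring

lemma areaForm_step_zero_field (hp : 1 - p ≠ 0) (ha : a = p / (1 - p)) (h2 h3 : K)
    (e2 : h2 = a * a + p) (e3 : h3 = a * h2 + p * a) :
    (1 - p + p ^ 2 - p ^ 3 + p ^ 4) * areaForm p 0 1 a =
      p * (1 - p) ^ 2 * (areaForm p 0 1 a + areaForm p 1 a h2 + areaForm p 2 h2 h3) := by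
  subst e3 e2 ha
  simp only [areaForm]
  field_simp
  ring

lemma areaForm_zero_field (hp : 1 - p ≠ 0) (ha : a = p / (1 - p)) :
    areaForm p 0 1 a = 2 * p ^ 2 * (4 - 7 * p + 4 * p ^ 2) *
      (3 - 6 * p + 11 * p ^ 2 - 8 * p ^ 3 + 2 * p ^ 4) := by
  subst ha
  simp only [areaForm]
  field_simp
  ring

/-- A rational parametrization of the quartic curve by p. -/
lemma quartic_field (hp : 1 - p ≠ 0) (hp' : 1 + p ≠ 0)
    (hN : 1 - p + p ^ 2 - p ^ 3 + p ^ 4 ≠ 0) (t Y : K)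
    (ht : t = p * (1 - p) ^ 2 / (1 - p + p ^ 2 - p ^ 3 + p ^ 4))
    (hY : Y = p ^ 2 * (3 - 6 * p + 11 * p ^ 2 - 8 * p ^ 3 + 2 * p ^ 4) /
      ((1 - p) ^ 2 * (1 + p) ^ 2)) :
    t ^ 2 * (775 * t ^ 4 - 1460 * t ^ 3 + 1006 * t ^ 2 - 264 * t + 24)
      + (425 * t ^ 6 - 1520 * t ^ 5 + 1527 * t ^ 4 - 68 * t ^ 3 - 282 * t ^ 2 + 88 * t - 8) * Y
      - t * (150 * t ^ 5 + 540 * t ^ 4 - 889 * t ^ 3 - 240 * t ^ 2 + 228 * t - 32) * Y ^ 2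
      - 2 * t ^ 2 * (5 * t + 4) * (5 * t ^ 3 - t ^ 2 - 17 * t + 4) * Y ^ 3
      + t ^ 4 * (5 * t + 4) ^ 2 * Y ^ 4 = 0 := by
  subst ht hY
  field_simp
  ring

end Field

end GenDyck

/-! ### Descent of the identities from the fraction field to a domain -/

namespace GenDyck

open PowerSeries

lemma map_areaForm {R K : Type*} [CommRing R] [CommRing K] (φ : R →+* K) (p y x z : R) :
    φ (areaForm p y x z) = areaForm (φ p) (φ y) (φ x) (φ z) := by
  simp [areaForm, map_ofNat]

lemma map_areaDenom {R K : Type*} [CommRing R] [CommRing K] (φ : R →+* K) (p : R) :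
    φ (areaDenom p) = areaDenom (φ p) := by
  simp [areaDenom, map_ofNat]

lemma one_sub_algebraMap_ne_zero {R : Type*} [CommRing R] {p : R} (hp : 1 - p ≠ 0) :
    1 - algebraMap R (FractionRing R) p ≠ 0 := by
  intro h
  refine hp (IsFractionRing.injective R (FractionRing R) ?_)
  simpa using h

section Domain

variable {R : Type*} [CommRing R] [IsDomain R] {p a : R}

lemma algebraMap_eq_div (hp : 1 - p ≠ 0) (ha : (1 - p) * a = p) :
    algebraMap R (FractionRing R) a =
      algebraMap R (FractionRing R) p / (1 - algebraMap R (FractionRing R) p) := by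
  rw [eq_div_iff (one_sub_algebraMap_ne_zero hp), mul_comm]
  simpa using congrArg (algebraMap R (FractionRing R)) ha

lemma countGF_step (hp : 1 - p ≠ 0) (ha : (1 - p) * a = p) (h0 h1 h2 h3 h4 : R)
    (e2 : h2 = a * h1 + p * h0) (e3 : h3 = a * h2 + p * h1) (e4 : h4 = a * h3 + p * h2) :
    (1 - p + p ^ 2 - p ^ 3 + p ^ 4) * h2 = p * (1 - p) ^ 2 * (h0 + h1 + h2 + h3 + h4) := by
  apply IsFractionRing.injective R (FractionRing R)
  simpa using countGF_step_field (one_sub_algebraMap_ne_zero hp) (algebraMap_eq_div hp ha)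
    (algebraMap R _ h0) (algebraMap R _ h1) (algebraMap R _ h2) (algebraMap R _ h3)
    (algebraMap R _ h4) (by simp [e2]) (by simp [e3]) (by simp [e4])

lemma areaForm_step (hp : 1 - p ≠ 0) (ha : (1 - p) * a = p) (y h0 h1 h2 h3 h4 h5 : R)
    (e2 : h2 = a * h1 + p * h0) (e3 : h3 = a * h2 + p * h1) (e4 : h4 = a * h3 + p * h2)
    (e5 : h5 = a * h4 + p * h3) :
    (1 - p + p ^ 2 - p ^ 3 + p ^ 4) * areaForm p (y + 2) h2 h3 =
      areaDenom p * (y + 2) * h2 + p * (1 - p) ^ 2 * (areaForm p y h0 h1 +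
        areaForm p (y + 1) h1 h2 + areaForm p (y + 2) h2 h3 + areaForm p (y + 3) h3 h4 +
        areaForm p (y + 4) h4 h5) := by
  apply IsFractionRing.injective R (FractionRing R)
  simpa [map_areaForm, map_areaDenom, map_ofNat] using
    areaForm_step_field (one_sub_algebraMap_ne_zero hp) (algebraMap_eq_div hp ha)
    (algebraMap R _ y) (algebraMap R _ h0) (algebraMap R _ h1) (algebraMap R _ h2)
    (algebraMap R _ h3) (algebraMap R _ h4) (algebraMap R _ h5)
    (by simp [e2]) (by simp [e3]) (by simp [e4]) (by simp [e5])

lemma areaForm_step_one (hp : 1 - p ≠ 0) (ha : (1 - p) * a = p) (h2 h3 h4 : R)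
    (e2 : h2 = a * a + p) (e3 : h3 = a * h2 + p * a) (e4 : h4 = a * h3 + p * h2) :
    (1 - p + p ^ 2 - p ^ 3 + p ^ 4) * areaForm p 1 a h2 =
      areaDenom p * a + p * (1 - p) ^ 2 * (areaForm p 0 1 a + areaForm p 1 a h2 +
        areaForm p 2 h2 h3 + areaForm p 3 h3 h4) := by
  apply IsFractionRing.injective R (FractionRing R)
  simpa [map_areaForm, map_areaDenom, map_ofNat] using
    areaForm_step_one_field (one_sub_algebraMap_ne_zero hp) (algebraMap_eq_div hp ha)
    (algebraMap R _ h2) (algebraMap R _ h3) (algebraMap R _ h4)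
    (by simp [e2]) (by simp [e3]) (by simp [e4])

lemma areaForm_step_zero (hp : 1 - p ≠ 0) (ha : (1 - p) * a = p) (h2 h3 : R)
    (e2 : h2 = a * a + p) (e3 : h3 = a * h2 + p * a) :
    (1 - p + p ^ 2 - p ^ 3 + p ^ 4) * areaForm p 0 1 a =
      p * (1 - p) ^ 2 * (areaForm p 0 1 a + areaForm p 1 a h2 + areaForm p 2 h2 h3) := by
  apply IsFractionRing.injective R (FractionRing R)
  simpa [map_areaForm, map_ofNat] using
    areaForm_step_zero_field (one_sub_algebraMap_ne_zero hp) (algebraMap_eq_div hp ha)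
    (algebraMap R _ h2) (algebraMap R _ h3) (by simp [e2]) (by simp [e3])

lemma areaForm_zero (hp : 1 - p ≠ 0) (ha : (1 - p) * a = p) :
    areaForm p 0 1 a = 2 * p ^ 2 * (4 - 7 * p + 4 * p ^ 2) *
      (3 - 6 * p + 11 * p ^ 2 - 8 * p ^ 3 + 2 * p ^ 4) := by
  apply IsFractionRing.injective R (FractionRing R)
  simpa [map_areaForm, map_ofNat] using
    areaForm_zero_field (one_sub_algebraMap_ne_zero hp) (algebraMap_eq_div hp ha)

lemma quartic (hp : 1 - p ≠ 0) (hp' : 1 + p ≠ 0)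
    (hN : 1 - p + p ^ 2 - p ^ 3 + p ^ 4 ≠ 0) (t Y : R)
    (ht : t * (1 - p + p ^ 2 - p ^ 3 + p ^ 4) = p * (1 - p) ^ 2)
    (hY : Y * ((1 - p) ^ 2 * (1 + p) ^ 2) =
      p ^ 2 * (3 - 6 * p + 11 * p ^ 2 - 8 * p ^ 3 + 2 * p ^ 4)) :
    t ^ 2 * (775 * t ^ 4 - 1460 * t ^ 3 + 1006 * t ^ 2 - 264 * t + 24)
      + (425 * t ^ 6 - 1520 * t ^ 5 + 1527 * t ^ 4 - 68 * t ^ 3 - 282 * t ^ 2 + 88 * t - 8) * Y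
      - t * (150 * t ^ 5 + 540 * t ^ 4 - 889 * t ^ 3 - 240 * t ^ 2 + 228 * t - 32) * Y ^ 2
      - 2 * t ^ 2 * (5 * t + 4) * (5 * t ^ 3 - t ^ 2 - 17 * t + 4) * Y ^ 3
      + t ^ 4 * (5 * t + 4) ^ 2 * Y ^ 4 = 0 := by
  have inj := IsFractionRing.injective R (FractionRing R)
  have hp1 := (map_ne_zero_iff _ inj).2 hp
  have hp2 := (map_ne_zero_iff _ inj).2 hp'
  have hN1 := (map_ne_zero_iff _ inj).2 hN
  have ht1 := congrArg (algebraMap R (FractionRing R)) ht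
  have hY1 := congrArg (algebraMap R (FractionRing R)) hY
  simp only [map_mul, map_sub, map_add, map_pow, map_one, map_ofNat] at hp1 hp2 hN1 ht1 hY1
  apply inj
  simpa [map_ofNat] using quartic_field hp1 hp2 hN1 _ _ (eq_div_of_mul_eq hN1 ht1)
    (eq_div_of_mul_eq (mul_ne_zero (pow_ne_zero 2 hp1) (pow_ne_zero 2 hp2)) hY1)

end Domain

/-! ### Closed forms for the generating functions and the quartic -/

section Series

variable {r a : PowerSeries ℤ}

lemma ne_zero_of_constantCoeff_ne_zero {f : PowerSeries ℤ} (h : constantCoeff f ≠ 0) : f ≠ 0 := by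
  rintro rfl
  simp at h

lemma one_sub_X_mul_ne_zero (r : PowerSeries ℤ) : 1 - X * r ≠ 0 :=
  ne_zero_of_constantCoeff_ne_zero (by simp)

lemma countGF_eq
    (hr : r * (1 - X * r) ^ 2 = 1 - X * r + (X * r) ^ 2 - (X * r) ^ 3 + (X * r) ^ 4)
    (ha : (1 - X * r) * a = X * r) (k : ℕ) :
    countGF k = r * kernelSeq a (X * r) k := by
  have hp := one_sub_X_mul_ne_zero r
  rw [← sub_eq_zero]
  refine eq_zero_of_transfer (fun k => countGF k - r * kernelSeq a (X * r) k) ?_ ?_ ?_ k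
  -- The source 1 is the term of the extension h(-2) = 1/p, since t r = p.
  · have : r = 1 + X * (r * (1 + a + (a * a + X * r * 1))) := by
      apply mul_left_cancel₀ (pow_ne_zero 2 hp)
      linear_combination hr - X * r * ((1 - X * r) + ((1 - X * r) * a + X * r)) * ha
    simp only [kernelSeq]
    linear_combination countGF_zero - this
  · have : r * a = X * (r * (1 + a + (a * a + X * r * 1) +
        (a * (a * a + X * r * 1) + X * r * a))) := by
      apply mul_left_cancel₀ (pow_ne_zero 2 hp)
      -- The leading 0 is h(-1).
      have := countGF_step hp ha 0 1 a _ _ (by ring) rfl rfl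
      linear_combination this + a * hr
    simp only [kernelSeq]
    linear_combination countGF_one - this
  · intro k
    have : r * kernelSeq a (X * r) (k + 2) = X * (r * (kernelSeq a (X * r) k +
        kernelSeq a (X * r) (k + 1) + kernelSeq a (X * r) (k + 2) + kernelSeq a (X * r) (k + 3) +
        kernelSeq a (X * r) (k + 4))) := by
      apply mul_left_cancel₀ (pow_ne_zero 2 hp)
      have := countGF_step hp ha (kernelSeq a (X * r) k) (kernelSeq a (X * r) (k + 1))
        (kernelSeq a (X * r) (k + 2)) (kernelSeq a (X * r) (k + 3))
        (kernelSeq a (X * r) (k + 4)) rfl rfl rfl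
      linear_combination this + kernelSeq a (X * r) (k + 2) * hr
    linear_combination countGF_add_two k - this

/-- With N = r(1 - p)^2 and p(1 - p)^2 = t N, multiplying the `areaForm` identities by `r` turns
their source into `areaDenom * k * countGF k`. Both sides thus solve the same equations. -/
lemma areaDenom_mul_heightGF
    (hr : r * (1 - X * r) ^ 2 = 1 - X * r + (X * r) ^ 2 - (X * r) ^ 3 + (X * r) ^ 4)
    (ha : (1 - X * r) * a = X * r) (k : ℕ) :
    areaDenom (X * r) * heightGF k = r * (r * (1 - X * r) ^ 2) *
      areaForm (X * r) (k : PowerSeries ℤ) (kernelSeq a (X * r) k) (kernelSeq a (X * r) (k + 1)) := by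
  have hp := one_sub_X_mul_ne_zero r
  rw [← sub_eq_zero]
  refine eq_zero_of_transfer (fun k => areaDenom (X * r) * heightGF k -
    r * (r * (1 - X * r) ^ 2) *
      areaForm (X * r) (k : PowerSeries ℤ) (kernelSeq a (X * r) k) (kernelSeq a (X * r) (k + 1))) ?_ ?_ ?_ k
  · have := areaForm_step_zero hp ha (kernelSeq a (X * r) 2) (kernelSeq a (X * r) 3)
      (by simp [kernelSeq]) (by simp [kernelSeq])
    rw [← hr] at this
    have h0 : kernelSeq a (X * r) 0 = 1 := rfl
    have h1 : kernelSeq a (X * r) 1 = a := rfl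
    simp only [zero_add, one_add_one_eq_two, Nat.reduceAdd, Nat.cast_zero, Nat.cast_one,
      Nat.cast_ofNat, h0, h1]
    linear_combination areaDenom (X * r) * heightGF_zero - r * this
  · have := areaForm_step_one hp ha (kernelSeq a (X * r) 2) (kernelSeq a (X * r) 3)
      (kernelSeq a (X * r) 4) (by simp [kernelSeq]) (by simp [kernelSeq]) rfl
    rw [← hr] at this
    have h0 : kernelSeq a (X * r) 0 = 1 := rfl
    have h1 : kernelSeq a (X * r) 1 = a := rfl
    have h := countGF_eq hr ha 1
    rw [h1] at h
    simp only [zero_add, one_add_one_eq_two, Nat.reduceAdd, Nat.cast_zero, Nat.cast_one,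
      Nat.cast_ofNat, h0, h1]
    linear_combination areaDenom (X * r) * heightGF_one - r * this + areaDenom (X * r) * h
  · intro k
    have := areaForm_step hp ha (k : PowerSeries ℤ) (kernelSeq a (X * r) k)
      (kernelSeq a (X * r) (k + 1)) (kernelSeq a (X * r) (k + 2)) (kernelSeq a (X * r) (k + 3))
      (kernelSeq a (X * r) (k + 4)) (kernelSeq a (X * r) (k + 5)) rfl rfl rfl rfl
    rw [← hr] at this
    have h := countGF_eq hr ha (k + 2)
    simp only [add_assoc, Nat.reduceAdd, Nat.cast_add, Nat.cast_one, Nat.cast_ofNat]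
    linear_combination areaDenom (X * r) * heightGF_add_two k - r * this
      + areaDenom (X * r) * (k + 2) * h

/-- The area generating function in terms of the kernel series. -/
lemma mul_areaGF_steps
    (hr : r * (1 - X * r) ^ 2 = 1 - X * r + (X * r) ^ 2 - (X * r) ^ 3 + (X * r) ^ 4) :
    (1 + X * r) ^ 2 * (1 - 3 * (X * r) + (X * r) ^ 2) ^ 2 * (1 - X * r + (X * r) ^ 2) ^ 2 *
        areaGF steps =
      r * (r * (1 - X * r) ^ 2) * (X * r) ^ 2 *
        (3 - 6 * (X * r) + 11 * (X * r) ^ 2 - 8 * (X * r) ^ 3 + 2 * (X * r) ^ 4) := by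
  obtain ⟨u, hu⟩ : IsUnit (1 - X * r) := by
    rw [isUnit_iff_constantCoeff]
    simp
  have ha : (1 - X * r) * (((u⁻¹ : (PowerSeries ℤ)ˣ) : PowerSeries ℤ) * (X * r)) = X * r := by
    rw [← hu, Units.mul_inv_cancel_left]
  have h := areaDenom_mul_heightGF hr ha 0
  have h2 := areaForm_zero (one_sub_X_mul_ne_zero r) ha
  simp only [Nat.cast_zero, kernelSeq] at h
  rw [h2, ← areaGF_steps, areaDenom] at h
  have hne : 2 * (4 - 7 * (X * r) + 4 * (X * r) ^ 2) ≠ 0 :=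
    ne_zero_of_constantCoeff_ne_zero (by simp [map_ofNat])
  apply mul_left_cancel₀ hne
  linear_combination h

theorem areaGF_steps_quartic :
    let t : PowerSeries ℤ := X
    let Y : PowerSeries ℤ := (t - 1) * (5 * t - 1) * areaGF steps
    t ^ 2 * (775 * t ^ 4 - 1460 * t ^ 3 + 1006 * t ^ 2 - 264 * t + 24)
      + (425 * t ^ 6 - 1520 * t ^ 5 + 1527 * t ^ 4 - 68 * t ^ 3 - 282 * t ^ 2 + 88 * t - 8) * Y
      - t * (150 * t ^ 5 + 540 * t ^ 4 - 889 * t ^ 3 - 240 * t ^ 2 + 228 * t - 32) * Y ^ 2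
      - 2 * t ^ 2 * (5 * t + 4) * (5 * t ^ 3 - t ^ 2 - 17 * t + 4) * Y ^ 3
      + t ^ 4 * (5 * t + 4) ^ 2 * Y ^ 4 = 0 := by
  obtain ⟨r, hr⟩ := exists_kernel_series
  have hA := mul_areaGF_steps hr
  have hp := one_sub_X_mul_ne_zero r
  have hp' : 1 + X * r ≠ 0 := ne_zero_of_constantCoeff_ne_zero (by simp)
  have hN : 1 - X * r + (X * r) ^ 2 - (X * r) ^ 3 + (X * r) ^ 4 ≠ 0 :=
    ne_zero_of_constantCoeff_ne_zero (by simp)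
  refine quartic hp hp' hN X _ (by rw [← hr]; ring) ?_
  generalize hpr : X * r = p at *
  have ht : X * (1 - p + p ^ 2 - p ^ 3 + p ^ 4) = p * (1 - p) ^ 2 := by
    rw [← hr, ← hpr]
    ring
  -- The factors t - 1 and 5t - 1 cancel the squares in the denominator of the area series.
  have h1 : (X - 1) * (1 - p + p ^ 2 - p ^ 3 + p ^ 4) = -(1 - p + p ^ 2) ^ 2 := by
    linear_combination ht
  have h5 : (5 * X - 1) * (1 - p + p ^ 2 - p ^ 3 + p ^ 4) = -(1 - 3 * p + p ^ 2) ^ 2 := by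
    linear_combination 5 * ht
  rw [hr] at hA
  generalize 1 - p + p ^ 2 - p ^ 3 + p ^ 4 = N at *
  apply mul_left_cancel₀ (pow_ne_zero 2 hN)
  calc N ^ 2 * ((X - 1) * (5 * X - 1) * areaGF steps * ((1 - p) ^ 2 * (1 + p) ^ 2))
      = ((X - 1) * N) * ((5 * X - 1) * N) * areaGF steps * ((1 - p) ^ 2 * (1 + p) ^ 2) := by ring
    _ = (1 - p) ^ 2 * ((1 + p) ^ 2 * (1 - 3 * p + p ^ 2) ^ 2 * (1 - p + p ^ 2) ^ 2 *
          areaGF steps) := by rw [h1, h5]; ring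
    _ = N ^ 2 * (p ^ 2 * (3 - 6 * p + 11 * p ^ 2 - 8 * p ^ 3 + 2 * p ^ 4)) := by
      rw [hA]
      linear_combination N * p ^ 2 * (3 - 6 * p + 11 * p ^ 2 - 8 * p ^ 3 + 2 * p ^ 4) * hr

end Series

end GenDyck

/-! ### Computation of the first thirty coefficients -/

namespace GenDyck

/-- The sums of five consecutive entries of a list. -/
def window : List ℤ → List ℤ
  | a :: b :: c :: d :: e :: l => (a + b + c + d + e) :: window (b :: c :: d :: e :: l)
  | _ => []

lemma window_map_range' (g : ℕ → ℤ) (i m : ℕ) :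
    window ((List.range' i (m + 4)).map g) =
      (List.range' i m).map fun j => g j + g (j + 1) + g (j + 2) + g (j + 3) + g (j + 4) := by
  induction m generalizing i with
  | zero => simp [List.range'_succ, window]
  | succ m ih =>
    have := ih (i + 1)
    simp only [List.range'_succ, List.map_cons, window, add_assoc, Nat.reduceAdd] at this ⊢
    rw [this]

/-- The two leading zeros are the values at heights -2 and -1; the top two heights are lost. -/
lemma window_cons_map_range (f : ℤ → ℤ) (hf : ∀ y < 0, f y = 0) (m : ℕ) :
    window (0 :: 0 :: (List.range (m + 2)).map fun k : ℕ => f k) =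
      (List.range m).map fun k : ℕ => ∑ s ∈ steps, f (k + s) := by
  have h : (0 :: 0 :: (List.range (m + 2)).map fun k : ℕ => f k) =
      (List.range' 0 (m + 4)).map fun j : ℕ => f (j - 2) := by
    rw [List.range'_succ, List.range'_succ, List.range_eq_range', List.map_cons, List.map_cons,
      hf _ (by norm_num), hf _ (by norm_num), zero_add, List.range'_eq_map_range,
      List.range'_eq_map_range, List.map_map, List.map_map]
    congr 3
    funext k
    simp only [Function.comp_apply]
    congr 1
    push_cast
    ring
  rw [h, window_map_range', ← List.range_eq_range']
  refine List.map_congr_left fun k _ => ?_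
  rw [sum_steps]
  push_cast
  ring_nf

/-- The numbers of walks of length `n` from the heights below `m` to height `0`. -/
def countRow (n m : ℕ) : List ℤ := (List.range m).map fun k : ℕ => countFrom steps n k

/-- The total heights of the walks of length `n` from the heights below `m` to height `0`. -/
def areaRow (n m : ℕ) : List ℤ := (List.range m).map fun k : ℕ => areaFrom steps n k

lemma countRow_succ (n m : ℕ) :
    countRow (n + 1) m = window (0 :: 0 :: countRow n (m + 2)) := by
  rw [countRow, countRow, window_cons_map_range _ fun y hy => countFrom_of_neg steps n hy]
  exact List.map_congr_left fun k _ => countFrom_succ _ _ (by positivity)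

lemma areaRow_succ (n m : ℕ) :
    areaRow (n + 1) m = List.zipWith (· + ·)
      ((countRow (n + 1) m).mapIdx fun k c => (k : ℤ) * c)
      (window (0 :: 0 :: areaRow n (m + 2))) := by
  rw [areaRow, areaRow, window_cons_map_range _ fun y hy => areaFrom_of_neg steps n hy, countRow]
  refine List.ext_getElem (by simp) fun k h1 h2 => ?_
  simp [areaFrom_succ]

/-- The total areas of the walks from height `0` to height `0` of `N` consecutive lengths, computed
from the rows of the first length. -/
def areaList : ℕ → List ℤ → List ℤ → List ℤ
  | 0, _, _ => []
  | N + 1, c, a => a.headD 0 :: areaList N (window (0 :: 0 :: c))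
      (List.zipWith (· + ·) ((window (0 :: 0 :: c)).mapIdx fun k c => (k : ℤ) * c)
        (window (0 :: 0 :: a)))

/-- Each length uses up two heights, so rows of size `2 * N` suffice, with no enumeration of the 5^n
step sequences. -/
lemma areaList_rows (N n : ℕ) :
    areaList N (countRow n (2 * N)) (areaRow n (2 * N)) =
      (List.range' n N).map fun k => areaFrom steps k 0 := by
  induction N generalizing n with
  | zero => rfl
  | succ N ih =>
    rw [areaList, mul_add, mul_one, ← countRow_succ, ← areaRow_succ, ih, List.range'_succ,
      List.map_cons]
    simp [areaRow, List.range_succ_eq_map]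

lemma coeff_areaGF_steps_range :
    (List.range 30).map (fun n => PowerSeries.coeff n (areaGF steps)) =
      [0, 0, 3, 18, 113, 636, 3487, 18656, 98429, 514012, 2664690, 13737758, 70522801,
        360806214, 1840913908, 9371761174, 47621259557, 241601881822, 1224111502194,
        6195045902854, 31321134873744, 158217553824544, 798622703316154, 4028438371631942,
        20308239308212037, 102323623873153810, 515313296262175206, 2594054240062008690,
        13053194513626873348, 65659889953142043376] := by
  have hc : countRow 0 60 = 1 :: List.replicate 59 0 := by
    simp only [countRow, countFrom_zero]
    decide +kernel
  have ha : areaRow 0 60 = List.replicate 60 0 := by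
    simp only [areaRow, areaFrom_zero]
    decide +kernel
  have h := areaList_rows 30 0
  rw [hc, ha, ← List.range_eq_range'] at h
  simp only [areaGF_steps, heightGF, PowerSeries.coeff_mk, Nat.cast_zero]
  rw [← h]
  decide +kernel

end GenDyck

theorem mainTheorem2 (S : Finset ℤ) (hS : S = {2, 1, 0, -1, -2})
    (t X : PowerSeries ℤ) (ht : t = PowerSeries.X) (hX : X = GenDyck.areaGF S) :
    (t ^ 2 * (775 * t ^ 4 - 1460 * t ^ 3 + 1006 * t ^ 2 - 264 * t + 24)
      + (t - 1) * (5 * t - 1)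
          * (425 * t ^ 6 - 1520 * t ^ 5 + 1527 * t ^ 4 - 68 * t ^ 3 - 282 * t ^ 2 + 88 * t - 8) * X
      - t * (150 * t ^ 5 + 540 * t ^ 4 - 889 * t ^ 3 - 240 * t ^ 2 + 228 * t - 32)
          * (t - 1) ^ 2 * (5 * t - 1) ^ 2 * X ^ 2
      - 2 * t ^ 2 * (5 * t + 4) * (5 * t ^ 3 - t ^ 2 - 17 * t + 4)
          * (t - 1) ^ 3 * (5 * t - 1) ^ 3 * X ^ 3
      + t ^ 4 * (5 * t + 4) ^ 2 * (t - 1) ^ 4 * (5 * t - 1) ^ 4 * X ^ 4 = 0) ∧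
    (List.range 30).map (fun n => PowerSeries.coeff n X) =
      [0, 0, 3, 18, 113, 636, 3487, 18656, 98429, 514012, 2664690, 13737758, 70522801,
        360806214, 1840913908, 9371761174, 47621259557, 241601881822, 1224111502194,
        6195045902854, 31321134873744, 158217553824544, 798622703316154, 4028438371631942,
        20308239308212037, 102323623873153810, 515313296262175206, 2594054240062008690,
        13053194513626873348, 65659889953142043376] := by
  subst hS ht hX
  refine ⟨?_, GenDyck.coeff_areaGF_steps_range⟩
  have h := GenDyck.areaGF_steps_quartic
  simp only at h
  linear_combination h
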